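/- Let $m\ge 1$ and let ${\bf d}=(d_1,\dots,d_m)$ and $\bm\delta=(\delta_1,\dots,\delta_m)$ be vectors of positive integers such that $\delta_i d_j\neq\delta_j d_i$ whenever $i\ne j$. For $1\le i\le m$ let ${\bf d}_i=(d_{i,1},\dots,d_{i,m})$ be the integer vector with $d_{i,i}=d_i$ and $d_{i,j}=\delta_i d_j-\delta_j d_i$ for $j\ne i$. For an integer vector ${\bf x}=(x_1,\dots,x_m)$ put $\pi({\bf x})=\prod_{j=1}^m x_j$, $\sigma_r({\bf x})=\sum_{j=1}^m x_j^r$ and $a_r({\bf x})=(-1)^{r-1}B_r\,\sigma_r({\bf x})/r$ for $r\ge1$, where $B_r$ are the Bernoulli numbers (with $B_1=-\tfrac12$). Let $\mathbb B_n$ be the complete Bell polynomials, defined by $$\exp\Big(\sum_{i\ge1}\frac{a_i}{i!}t^i\Big)=\sum_{n\ge0}\mathbb B_n(a_1,a_2,\dots)\frac{t^n}{n!},$$ and write $\mathbb B_n(a({\bf x}))=\mathbb B_n(a_1({\bf x}),a_2({\bf x}),\dots)$. Then the following hold. 1. For every integer $k$ with $0\le k\le m-1$, $$\frac{\mathbb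 B_{m-k-1}(a({\bf d}))}{\pi({\bf d})}=\sum_{i=1}^m\frac{\delta_i^k\,\mathbb B_{m-k-1}(a({\bf d}_i))}{\pi({\bf d}_i)}.$$ 2. $\displaystyle\sum_{i=1}^m\sigma_1({\bf d}_i)=\sigma_1({\bf d})$, equivalently $\displaystyle\frac1{\sigma_1({\bf d})}\sum_{i=1}^m\sigma_1({\bf d}_i)=1$. 3. $\displaystyle\pi({\bf d})\sum_{i=1}^m\frac{\delta_i^{m-1}}{\pi({\bf d}_i)}=1$. 4. If $m\ge2$, then $\displaystyle\frac{\pi({\bf d})}{\sigma_1({\bf d})}\sum_{i=1}^m\frac{\delta_i^{m-2}\sigma_1({\bf d}_i)}{\pi({\bf d}_i)}=1$. 5. If $m\ge3$, then $\displaystyle\frac{\pi({\bf d})}{3\sigma_1^2({\bf d})-\sigma_2({\bf d})}\sum_{i=1}^m\delta_i^{m-3}\,\frac{3\sigma_1^2({\bf d}_i)-\sigma_2({\bf d}_i)}{\pi({\bf d}_i)}=1$. -/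

import Mathlib

namespace BellPartition

/-- The `n`-th complete Bell polynomial evaluated at `a₁, a₂, …` (the entry `a 0` is ignored),
defined by its exponential generating function
`exp (∑_{i ≥ 1} aᵢ tⁱ / i!) = ∑_{n ≥ 0} 𝔹ₙ(a₁, a₂, …) tⁿ / n!`. -/
noncomputable def completeBell (n : ℕ) (a : ℕ → ℚ) : ℚ :=
  (n.factorial : ℚ) * PowerSeries.coeff n
    ((PowerSeries.exp ℚ).subst
      (PowerSeries.mk fun i => if i = 0 then (0 : ℚ) else a i / (i.factorial : ℚ)))

/-- The power sum `σ_r(d) = ∑_j d_j ^ r`. -/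
def powerSum {m : ℕ} (r : ℕ) (d : Fin m → ℤ) : ℚ := ∑ j, (d j : ℚ) ^ r

/-- The product `π(d) = ∏_j d_j`. -/
def genProd {m : ℕ} (d : Fin m → ℤ) : ℚ := ∏ j, (d j : ℚ)

/-- The sequence `a_r(d) = (-1)^(r-1) B_r σ_r(d) / r` for `r ≥ 1`, where `B_r` is the Bernoulli
number with `B_1 = -1/2`. The entry at `r = 0` is never used. -/
def bellArg {m : ℕ} (d : Fin m → ℤ) (r : ℕ) : ℚ :=
  (-1) ^ (r - 1) * bernoulli r * powerSum r d / r

/-- The generators `d_i`, with entries `d_{i,i} = d_i` and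
`d_{i,j} = δ_i d_j - δ_j d_i` for `j ≠ i`. -/
def reduced {m : ℕ} (d δ : Fin m → ℤ) (i : Fin m) : Fin m → ℤ :=
  fun j => if j = i then d i else δ i * d j - δ j * d i

end BellPartition

/-!
All the identities come from the first one, a partial fraction identity.

Attach to a rational parameter `z` the `m + 1` linear forms `z` and `d_j - δ_j z`, and let `P(z)` be
the complete Bell polynomial `𝔹ₙ` at `c_r (z ^ r + ∑_j (d_j - δ_j z) ^ r)`, where
`c_r = (-1) ^ (r - 1) B_r / r`.
Since `𝔹ₙ` is isobaric of weight `n`, `P` is a polynomial of degree at most `n`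
(`exists_polynomial_eval_eq_completeBell`). Its values at the `m + 1` distinct points `0` and
`d_i / δ_i` at which one of the forms vanishes are `𝔹ₙ(a(d))` and `δ_i ^ (-n) 𝔹ₙ(a(d_i))`
(`completeBell_pencil_zero`, `completeBell_pencil_node`). If `n < m`, Lagrange interpolation says
that the sum of these values, divided by the products of the differences of the points, is the
coefficient of `z ^ m` in `P`, which is zero. Clearing the powers of the `δ_i` gives
`completeBell_div_genProd`. Only the shape `a_r = c_r σ_r` matters here, not the values of the `c_r`.

The Bernoulli numbers enter only in the explicit forms `𝔹₀ = 1`, `𝔹₁ = -σ₁ / 2` and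
`𝔹₂ = (3 σ₁² - σ₂) / 12`, which turn the cases `n = 0, 1, 2` into the last three identities. The
identity for the sums `σ₁(d_i)` holds because `δ_i d_j - δ_j d_i` is antisymmetric in `i` and `j`.
-/

namespace BellPartition

open PowerSeries Finset

/-! ### Complete Bell polynomials -/

/-- The exponent `∑_{i ≥ 1} aᵢ tⁱ / i!` may be substituted into a power series. -/
theorem hasSubst_bellExponent (a : ℕ → ℚ) :
    HasSubst (PowerSeries.mk fun i => if i = 0 then (0 : ℚ) else a i / (i.factorial : ℚ)) :=
  HasSubst.of_constantCoeff_zero' (by simp [← coeff_zero_eq_constantCoeff_apply])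

@[simp]
theorem completeBell_zero (a : ℕ → ℚ) : completeBell 0 a = 1 := by
  have h : constantCoeff (PowerSeries.mk fun i =>
      if i = 0 then (0 : ℚ) else a i / (i.factorial : ℚ)) = 0 := by
    simp [← coeff_zero_eq_constantCoeff_apply]
  have hc := constantCoeff_subst (hasSubst_bellExponent a) (PowerSeries.exp ℚ)
  rw [finsum_eq_single _ 0 fun k hk => ?_] at hc
  · rw [completeBell, coeff_zero_eq_constantCoeff_apply]
    refine (congrArg _ hc).trans ?_
    simp
  · rw [map_pow, show MvPowerSeries.constantCoeff _ = _ from h, zero_pow hk, smul_zero]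

/-- The recursion obtained by differentiating the exponential generating function. -/
theorem completeBell_succ (n : ℕ) (a : ℕ → ℚ) :
    completeBell (n + 1) a = n.factorial * ∑ p ∈ antidiagonal n,
      completeBell p.1 a / p.1.factorial * (a (p.2 + 1) / p.2.factorial) := by
  have h := congrArg (coeff n) (derivative_subst (f := PowerSeries.exp ℚ) (hasSubst_bellExponent a))
  rw [coeff_derivative, derivative_exp, coeff_mul] at h
  rw [completeBell, Nat.factorial_succ, Nat.cast_mul, Nat.cast_succ, mul_comm ((n : ℚ) + 1),
    mul_assoc, mul_comm ((n : ℚ) + 1), h]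
  congr 1
  refine sum_congr rfl fun p _ => ?_
  have h₁ : (p.1.factorial : ℚ) ≠ 0 := by positivity
  have h₂ : (p.2.factorial : ℚ) ≠ 0 := by positivity
  have h₃ : (p.2 : ℚ) + 1 ≠ 0 := by positivity
  rw [coeff_derivative, coeff_mk, if_neg p.2.succ_ne_zero, completeBell, Nat.factorial_succ]
  push_cast
  field_simp

theorem completeBell_one (a : ℕ → ℚ) : completeBell 1 a = a 1 := by
  simp [completeBell_succ]

theorem completeBell_two (a : ℕ → ℚ) : completeBell 2 a = a 1 ^ 2 + a 2 := by
  rw [completeBell_succ 1, Nat.sum_antidiagonal_eq_sum_range_succ_mk]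
  simp [sum_range_succ, completeBell_one]
  ring

/-- The polynomial `𝔹ₙ` is isobaric of weight `n`. -/
theorem completeBell_eq_pow_mul {a b : ℕ → ℚ} {c : ℚ} (h : ∀ r, 1 ≤ r → b r = c ^ r * a r) (n : ℕ) :
    completeBell n b = c ^ n * completeBell n a := by
  induction n using Nat.strong_induction_on with
  | _ n ih =>
    cases n with
    | zero => simp
    | succ n =>
      rw [completeBell_succ, completeBell_succ, mul_left_comm, mul_sum _ _ (c ^ (n + 1))]
      congr 1
      refine sum_congr rfl fun p hp => ?_
      have hp' := mem_antidiagonal.1 hp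
      rw [ih p.1 (by lia), h (p.2 + 1) (by lia), ← hp']
      ring

/-- If the `r`-th argument is a polynomial function of degree at most `r` of a parameter, then the
value of `𝔹ₙ` is a polynomial function of degree at most `n` of it. -/
theorem exists_polynomial_eval_eq_completeBell {a : ℚ → ℕ → ℚ}
    (h : ∀ r, ∃ A : Polynomial ℚ, A.natDegree ≤ r ∧ ∀ z, A.eval z = a z r) (n : ℕ) :
    ∃ P : Polynomial ℚ, P.natDegree ≤ n ∧ ∀ z, P.eval z = completeBell n (a z) := by
  choose A hA hAe using h
  induction n using Nat.strong_induction_on with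
  | _ n ih =>
    cases n with
    | zero => exact ⟨1, by simp, by simp⟩
    | succ n =>
      choose! P hP hPe using ih
      refine ⟨Polynomial.C (n.factorial : ℚ) * ∑ p ∈ antidiagonal n,
        Polynomial.C ((p.1.factorial : ℚ)⁻¹ * (p.2.factorial : ℚ)⁻¹) * (P p.1 * A (p.2 + 1)),
        ?_, fun z => ?_⟩
      · refine (Polynomial.natDegree_C_mul_le _ _).trans
          (Polynomial.natDegree_sum_le_of_forall_le _ _ fun p hp => ?_)
        have hp' := mem_antidiagonal.1 hp
        refine (Polynomial.natDegree_C_mul_le _ _).trans (Polynomial.natDegree_mul_le.trans ?_)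
        have h₁ := hP p.1 (by lia)
        have h₂ := hA (p.2 + 1)
        lia
      · rw [completeBell_succ, Polynomial.eval_mul, Polynomial.eval_C, Polynomial.eval_finsetSum]
        congr 1
        refine sum_congr rfl fun p hp => ?_
        have hp' := mem_antidiagonal.1 hp
        rw [Polynomial.eval_mul, Polynomial.eval_C, Polynomial.eval_mul, hPe p.1 (by lia), hAe]
        ring

/-! ### The interpolating polynomial -/

variable {m : ℕ}

/-- The Bell arguments `c_r (z ^ r + ∑_j (d_j - δ_j z) ^ r)` of the `m + 1` linear forms `z` and
`d_j - δ_j z`, where `c_r = (-1) ^ (r - 1) B_r / r`. -/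
def pencilArg (d δ : Fin m → ℤ) (z : ℚ) (r : ℕ) : ℚ :=
  (-1) ^ (r - 1) * bernoulli r / r * (z ^ r + ∑ j, ((d j : ℚ) - δ j * z) ^ r)

theorem exists_polynomial_eval_eq_pencilArg (d δ : Fin m → ℤ) (r : ℕ) :
    ∃ A : Polynomial ℚ, A.natDegree ≤ r ∧ ∀ z, A.eval z = pencilArg d δ z r := by
  refine ⟨Polynomial.C ((-1) ^ (r - 1) * bernoulli r / r) * (Polynomial.X ^ r +
    ∑ j, (Polynomial.C (d j : ℚ) - Polynomial.C (δ j : ℚ) * Polynomial.X) ^ r), ?_, fun z => ?_⟩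
  · refine (Polynomial.natDegree_C_mul_le _ _).trans
      (Polynomial.natDegree_add_le_of_degree_le (by simp)
        (Polynomial.natDegree_sum_le_of_forall_le _ _ fun j _ => ?_))
    have h : (Polynomial.C (d j : ℚ) - Polynomial.C (δ j : ℚ) * Polynomial.X).natDegree ≤ 1 :=
      (Polynomial.natDegree_sub_le _ _).trans
        (max_le (by simp) ((Polynomial.natDegree_C_mul_le _ _).trans (by simp)))
    exact (Polynomial.natDegree_pow_le_of_le r h).trans (by simp)
  · simp [pencilArg, Polynomial.eval_finsetSum]

theorem completeBell_pencil_zero (d δ : Fin m → ℤ) (n : ℕ) :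
    completeBell n (pencilArg d δ 0) = completeBell n (bellArg d) := by
  rw [completeBell_eq_pow_mul (a := bellArg d) (c := 1) fun r hr => ?_, one_pow, one_mul]
  have hr : r ≠ 0 := by lia
  simp only [pencilArg, bellArg, powerSum, mul_zero, sub_zero, zero_pow hr, one_pow]
  ring

/-- At `z = d_i / δ_i` the forms `z` and `d_j - δ_j z` are the entries of `d_i` divided by `δ_i`,
together with the vanishing form `d_i - δ_i z`. -/
theorem completeBell_pencil_node (d δ : Fin m → ℤ) (i : Fin m) (hi : δ i ≠ 0) (n : ℕ) :
    completeBell n (pencilArg d δ (d i / δ i)) =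
      (δ i : ℚ)⁻¹ ^ n * completeBell n (bellArg (reduced d δ i)) := by
  refine completeBell_eq_pow_mul (fun r hr => ?_) n
  have hr : r ≠ 0 := by lia
  have hi : (δ i : ℚ) ≠ 0 := by exact_mod_cast hi
  have key : ((d i : ℚ) / δ i) ^ r + ∑ j, ((d j : ℚ) - δ j * (d i / δ i)) ^ r =
      (δ i : ℚ)⁻¹ ^ r * powerSum r (reduced d δ i) := by
    rw [powerSum, mul_sum, ← add_sum_erase _ _ (mem_univ i), ← add_sum_erase _ _ (mem_univ i),
      mul_div_cancel₀ _ hi, sub_self, zero_pow hr, zero_add]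
    congr 1
    · simp only [reduced, if_pos]
      rw [← mul_pow]
      ring
    · refine sum_congr rfl fun j hj => ?_
      rw [reduced, if_neg (ne_of_mem_erase hj), ← mul_pow]
      congr 1
      push_cast
      field_simp
  rw [pencilArg, bellArg, key]
  ring

/-! ### The partial fraction identity -/

/-- The points at which one of the forms `z` and `d_j - δ_j z` vanishes. -/
def pencilNode (d δ : Fin m → ℤ) (o : Option (Fin m)) : ℚ :=
  o.elim 0 fun i => d i / δ i

theorem pencilNode_injective {d δ : Fin m → ℤ} (hd : ∀ i, d i ≠ 0) (hδ : ∀ i, δ i ≠ 0)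
    (hnc : ∀ i j, i ≠ j → δ i * d j ≠ δ j * d i) : Function.Injective (pencilNode d δ) := by
  have hd' (i) : (d i : ℚ) ≠ 0 := by exact_mod_cast hd i
  have hδ' (i) : (δ i : ℚ) ≠ 0 := by exact_mod_cast hδ i
  rintro (_ | i) (_ | j) h
  · rfl
  · exact absurd h.symm (div_ne_zero (hd' j) (hδ' j))
  · exact absurd h (div_ne_zero (hd' i) (hδ' i))
  · by_contra hij
    refine hnc i j (fun e => hij (congrArg some e)) ?_
    have h : (d i : ℚ) / δ i = d j / δ j := h
    rw [div_eq_div_iff (hδ' i) (hδ' j)] at h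
    have h : d i * δ j = d j * δ i := by exact_mod_cast h
    linarith

theorem prod_pencilNode_none (d δ : Fin m → ℤ) :
    ∏ o ∈ univ.erase none, (pencilNode d δ none - pencilNode d δ o) =
      (-1) ^ m * (genProd d / genProd δ) := by
  have h : univ.erase (none : Option (Fin m)) = univ.map Function.Embedding.some := by
    ext o; cases o <;> simp
  rw [h, prod_map, genProd, genProd, ← prod_div_distrib]
  simp [pencilNode, prod_neg]

theorem prod_pencilNode_some (d δ : Fin m → ℤ) (hδ : ∀ i, δ i ≠ 0) (i : Fin m) :
    ∏ o ∈ univ.erase (some i), (pencilNode d δ (some i) - pencilNode d δ o) =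
      -((-1) ^ m * (genProd (reduced d δ i) / ((δ i : ℚ) ^ (m - 1) * genProd δ))) := by
  have hδ' (i) : (δ i : ℚ) ≠ 0 := by exact_mod_cast hδ i
  have h : univ.erase (some i) = insertNone (univ.erase i) := by
    ext o; cases o <;> simp
  have hcard : #(univ.erase i) = m - 1 := by simp
  have hm : m = m - 1 + 1 := by have := i.pos; lia
  have hprod : ∏ j ∈ univ.erase i, ((d i : ℚ) / δ i - d j / δ j) =
      (-1) ^ (m - 1) * ((∏ j ∈ univ.erase i, (reduced d δ i j : ℚ)) /
        ((δ i : ℚ) ^ (m - 1) * ∏ j ∈ univ.erase i, (δ j : ℚ))) := by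
    rw [← hcard, ← prod_const, ← prod_const, ← prod_mul_distrib, ← prod_div_distrib,
      ← prod_mul_distrib]
    refine prod_congr rfl fun j hj => ?_
    have := hδ' i
    have := hδ' j
    rw [reduced, if_neg (ne_of_mem_erase hj)]
    push_cast
    field_simp
    ring
  have hpow : (-1 : ℚ) ^ m = -(-1) ^ (m - 1) := by
    conv_lhs => rw [hm, pow_succ]
    ring
  rw [h, prod_insertNone, genProd, genProd, ← mul_prod_erase univ _ (mem_univ i),
    ← mul_prod_erase univ (fun j => (δ j : ℚ)) (mem_univ i), hpow]
  simp only [pencilNode, Option.elim, sub_zero]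
  rw [hprod]
  simp only [reduced, if_pos]
  have := hδ' i
  have : ∏ j ∈ univ.erase i, (δ j : ℚ) ≠ 0 := prod_ne_zero_iff.2 fun j _ => hδ' j
  field_simp

theorem genProd_ne_zero {x : Fin m → ℤ} (hx : ∀ i, x i ≠ 0) : genProd x ≠ 0 :=
  prod_ne_zero_iff.2 fun i _ => by exact_mod_cast hx i

/-- The Lagrange interpolation sum of `P(z) = 𝔹ₙ(pencilArg d δ z)` over the `m + 1` nodes vanishes,
because `P` has degree at most `n < m`. -/
theorem completeBell_div_genProd {d δ : Fin m → ℤ} (hd : ∀ i, d i ≠ 0) (hδ : ∀ i, δ i ≠ 0)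
    (hnc : ∀ i j, i ≠ j → δ i * d j ≠ δ j * d i) {k : ℕ} (hk : k < m) :
    completeBell (m - k - 1) (bellArg d) / genProd d =
      ∑ i, (δ i : ℚ) ^ k * completeBell (m - k - 1) (bellArg (reduced d δ i)) /
        genProd (reduced d δ i) := by
  obtain ⟨P, hdeg, hP⟩ := exists_polynomial_eval_eq_completeBell
    (exists_polynomial_eval_eq_pencilArg d δ) (m - k - 1)
  have hcard : #(univ : Finset (Option (Fin m))) = m + 1 := by simp
  have hlt : P.natDegree < m := by lia
  have h := Lagrange.coeff_eq_sum (s := univ) (v := pencilNode d δ)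
    (pencilNode_injective hd hδ hnc).injOn (P := P)
    (by rw [hcard]; exact Polynomial.degree_le_natDegree.trans_lt (by exact_mod_cast hlt.trans m.lt_succ_self))
  rw [hcard, Nat.add_sub_cancel, Polynomial.coeff_eq_zero_of_natDegree_lt hlt, univ_option,
    sum_insertNone, ← univ_option, prod_pencilNode_none, hP] at h
  change 0 = completeBell _ (pencilArg d δ 0) / _ + _ at h
  rw [completeBell_pencil_zero] at h
  have hδg : genProd δ ≠ 0 := genProd_ne_zero hδ
  have hsum : ∑ i, Polynomial.eval (pencilNode d δ (some i)) P /
      ∏ o ∈ univ.erase (some i), (pencilNode d δ (some i) - pencilNode d δ o) =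
      -((-1) ^ m * genProd δ * ∑ i, (δ i : ℚ) ^ k *
        completeBell (m - k - 1) (bellArg (reduced d δ i)) / genProd (reduced d δ i)) := by
    rw [mul_sum, ← sum_neg_distrib]
    refine sum_congr rfl fun i _ => ?_
    have hδi : (δ i : ℚ) ≠ 0 := by exact_mod_cast hδ i
    have hpow : (δ i : ℚ) ^ (m - 1) = δ i ^ k * δ i ^ (m - k - 1) := by
      rw [← pow_add]; congr 1; lia
    rw [prod_pencilNode_some d δ hδ, hP]
    change completeBell _ (pencilArg d δ (d i / δ i)) / _ = _
    rw [completeBell_pencil_node d δ i (hδ i), hpow, inv_pow]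
    rcases neg_one_pow_eq_or ℚ m with hs | hs <;> rw [hs] <;> field_simp
  rw [hsum] at h
  have hs : (-1 : ℚ) ^ m ≠ 0 := by simp
  have hcancel : (-1 : ℚ) ^ m * genProd δ * (completeBell (m - k - 1) (bellArg d) / genProd d) =
      (-1) ^ m * genProd δ * ∑ i, (δ i : ℚ) ^ k *
        completeBell (m - k - 1) (bellArg (reduced d δ i)) / genProd (reduced d δ i) := by
    rw [← sub_eq_zero, sub_eq_add_neg, h]
    congr 1
    rcases neg_one_pow_eq_or ℚ m with hs | hs <;> rw [hs] <;> field_simp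
  exact mul_left_cancel₀ (mul_ne_zero hs hδg) hcancel

/-! ### The first Bell polynomials and power sums -/

theorem completeBell_one_bellArg (x : Fin m → ℤ) :
    completeBell 1 (bellArg x) = -1 / 2 * powerSum 1 x := by
  simp [completeBell_one, bellArg]

theorem completeBell_two_bellArg (x : Fin m → ℤ) :
    completeBell 2 (bellArg x) = (3 * powerSum 1 x ^ 2 - powerSum 2 x) / 12 := by
  simp [completeBell_two, bellArg]
  ring

/-- The differences `δ_i d_j - δ_j d_i` are antisymmetric, so they cancel in the total sum. -/
theorem sum_powerSum_one_reduced (d δ : Fin m → ℤ) :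
    ∑ i, powerSum 1 (reduced d δ i) = powerSum 1 d := by
  have h (i j : Fin m) : (reduced d δ i j : ℚ) =
      (if j = i then (d i : ℚ) else 0) + (δ i * d j - δ j * d i) := by
    rw [reduced]
    split_ifs with hij
    · subst hij; ring
    · push_cast; ring
  simp only [powerSum, pow_one, h, sum_add_distrib, sum_sub_distrib, sum_ite_eq', mem_univ, if_true]
  rw [sum_comm (f := fun i j => (δ i : ℚ) * d j), sub_self, add_zero]

theorem powerSum_pos (hm : 1 ≤ m) {d : Fin m → ℤ} (hd : ∀ i, 0 < d i) (r : ℕ) :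
    0 < powerSum r d :=
  sum_pos (fun i _ => pow_pos (by exact_mod_cast hd i) r) ⟨⟨0, hm⟩, mem_univ _⟩

theorem powerSum_two_le {d : Fin m → ℤ} (hd : ∀ i, 0 < d i) :
    powerSum 2 d ≤ powerSum 1 d ^ 2 := by
  simpa [powerSum] using
    sum_sq_le_sq_sum_of_nonneg (s := univ) (f := fun i => (d i : ℚ)) fun i _ => by exact_mod_cast (hd i).le

end BellPartition

theorem mainTheorem3 (m : ℕ) (hm : 1 ≤ m) (d δ : Fin m → ℤ)
    (hd : ∀ i, 0 < d i) (hδ : ∀ i, 0 < δ i)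
    (hnc : ∀ i j, i ≠ j → δ i * d j ≠ δ j * d i) :
    (∀ k : ℕ, k < m →
      BellPartition.completeBell (m - k - 1) (BellPartition.bellArg d) / BellPartition.genProd d =
        ∑ i, (δ i : ℚ) ^ k *
          BellPartition.completeBell (m - k - 1)
            (BellPartition.bellArg (BellPartition.reduced d δ i)) /
          BellPartition.genProd (BellPartition.reduced d δ i)) ∧
    (∑ i, BellPartition.powerSum 1 (BellPartition.reduced d δ i) = BellPartition.powerSum 1 d ∧
      1 / BellPartition.powerSum 1 d *
        ∑ i, BellPartition.powerSum 1 (BellPartition.reduced d δ i) = 1) ∧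
    BellPartition.genProd d *
      ∑ i, (δ i : ℚ) ^ (m - 1) / BellPartition.genProd (BellPartition.reduced d δ i) = 1 ∧
    (2 ≤ m →
      BellPartition.genProd d / BellPartition.powerSum 1 d *
        ∑ i, (δ i : ℚ) ^ (m - 2) * BellPartition.powerSum 1 (BellPartition.reduced d δ i) /
          BellPartition.genProd (BellPartition.reduced d δ i) = 1) ∧
    (3 ≤ m →
      BellPartition.genProd d /
          (3 * BellPartition.powerSum 1 d ^ 2 - BellPartition.powerSum 2 d) *
        ∑ i, (δ i : ℚ) ^ (m - 3) *
          ((3 * BellPartition.powerSum 1 (BellPartition.reduced d δ i) ^ 2 -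
              BellPartition.powerSum 2 (BellPartition.reduced d δ i)) /
            BellPartition.genProd (BellPartition.reduced d δ i)) = 1) := by
  open BellPartition in
  have hd' : ∀ i, d i ≠ 0 := fun i => (hd i).ne'
  have main := fun k (hk : k < m) =>
    completeBell_div_genProd hd' (fun i => (hδ i).ne') hnc hk
  have hπ : genProd d ≠ 0 := genProd_ne_zero hd'
  have hσ : 0 < powerSum 1 d := powerSum_pos hm hd 1
  refine ⟨main, ⟨sum_powerSum_one_reduced d δ, ?_⟩, ?_, fun h2 => ?_, fun h3 => ?_⟩
  · rw [sum_powerSum_one_reduced, one_div_mul_cancel hσ.ne']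
  · have h := main (m - 1) (by lia)
    rw [show m - (m - 1) - 1 = 0 by lia] at h
    simp only [completeBell_zero, mul_one] at h
    rw [← h, mul_one_div_cancel hπ]
  · have h := main (m - 2) (by lia)
    rw [show m - (m - 2) - 1 = 1 by lia] at h
    simp only [completeBell_one_bellArg, mul_left_comm _ (-1 / 2 : ℚ), mul_div_assoc (-1 / 2 : ℚ),
      ← Finset.mul_sum] at h
    rw [← mul_left_cancel₀ (by norm_num : (-1 / 2 : ℚ) ≠ 0) h]
    field_simp
  · have h := main (m - 3) (by lia)
    rw [show m - (m - 3) - 1 = 2 by lia] at h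
    simp only [completeBell_two_bellArg, mul_div_assoc', div_right_comm _ (12 : ℚ),
      ← Finset.sum_div] at h
    have hne : 3 * powerSum 1 d ^ 2 - powerSum 2 d ≠ 0 := by
      have h₁ := powerSum_two_le hd
      have h₂ := pow_pos hσ 2
      exact ne_of_gt (by linarith)
    simp only [mul_div_assoc']
    rw [← (div_left_inj' (by norm_num : (12 : ℚ) ≠ 0)).1 h]
    field_simp
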